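/- A *trace* on a group $G$ is a function $\varphi:G\to\mathbb{C}$ that is positive-definite ($\sum_{i,j}\alpha_i\overline{\alpha_j}\,\varphi(g_j^{-1}g_i)\ge 0$ for all finite families $g_i\in G$, $\alpha_i\in\mathbb{C}$), conjugation-invariant and normalized by $\varphi(e)=1$. The space $\mathrm{Tr}(G)$ of traces is convex and carries the topology of pointwise convergence; its extreme points are the *characters*, and they form the set $\mathrm{Ch}(G)$. Let $G$ be a group with a finite generating set $S$, and let $\theta_n:G\to G_n$ $(n\in\mathbb{N})$ be a LEF approximation: the groups $G_n$ are finite, for all $g,h\in G$ one has $\theta_n(gh)=\theta_n(g)\theta_n(h)$ for all large $n$, and for all $g\ne e$ one has $\theta_n(g)\neq e$ for all large $n$. Assume that it is essential and by simple groups: the groups $G_n$ are simple and pairwise non-isomorphic, and for every $n$ the restriction $\theta_n|_S$ does not extend to a homomorphism $G\to G_n$ and $\theta_n(S)$ generates $G_n$. Let $\Gamma=\bigotimes G_n\le\prod_n G_n$ be the associated diagonal product, i.e. the subgroup generated by the elements $\gamma_s=(\theta_n(s))_n$, $s\in S$. Let $t:\Gamma\to G$ be the tail map, i.e. the homomorphism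 with $t(\gamma_s)=s$ for all $s\in S$; equivalently, $t(\gamma)$ is the unique $g\in G$ with $\gamma_n=\theta_n(g)$ for all large $n$. 1. The map $t$ is surjective, $\Gamma$ contains $U:=\bigoplus_n G_n$, and $\ker t=U$. The tensor product $(\varphi_n)_n\mapsto\bigotimes_n\varphi_n$, where $(\bigotimes_n\varphi_n)(u)=\prod_n\varphi_n(u_n)$, is a bijection $\prod_n\mathrm{Ch}(G_n)\to\mathrm{Ch}(U)$. For $\varphi=(\varphi_n)\in\prod_n\mathrm{Ch}(G_n)$, an element $\tau\in G$ is *null* for $\varphi$ if $\prod_{i}|\varphi_i(\gamma_i)|=0$ for every $\gamma\in\Gamma$ with $t(\gamma)=\tau$. A trace $\psi\in\mathrm{Tr}(G)$ is *compatible* with $\varphi$ if $\psi(\tau)=0$ for every $\tau$ that is null for $\varphi$. The extreme points of the convex set of compatible traces are the *compatible characters* for $\varphi$. An *auxiliary trace* for $\varphi$ is an accumulation point $\widehat\varphi$, for pointwise convergence on $\Gamma$, of the sequence of functions $\gamma\mapsto\prod_{i\le n}\varphi_i(\gamma_i)$. 2. Let $\varphi\in\prod_n\mathrm{Ch}(G_n)$.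 Auxiliary traces for $\varphi$ exist, each of them belongs to $\mathrm{Tr}(\Gamma)$, and for each of them the map $\psi\mapsto\widehat\varphi\cdot(\psi\circ t)$ is an affine homeomorphism $$\{\psi\in\mathrm{Tr}(G):\psi\text{ is compatible with }\varphi\}\;\cong\;\{\zeta\in\mathrm{Tr}(\Gamma):\zeta|_U=\textstyle\bigotimes_n\varphi_n\}.$$ It restricts to a homeomorphism of the set of compatible characters for $\varphi$ onto $\{\zeta\in\mathrm{Ch}(\Gamma):\zeta|_U=\bigotimes_n\varphi_n\}$. 3. Consequently, for any choice of an auxiliary trace $\widehat\varphi$ for each $\varphi\in\prod_n\mathrm{Ch}(G_n)$, the map $(\varphi,\psi)\mapsto\widehat\varphi\cdot(\psi\circ t)$ is a bijection $$\Big\{(\varphi,\psi)\in\prod_n\mathrm{Ch}(G_n)\times\mathrm{Tr}(G):\psi\text{ is a compatible character for }\varphi\Big\}\;\longrightarrow\;\mathrm{Ch}(\Gamma).$$ -/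

import Mathlib

open Filter Topology
open scoped ComplexOrder

noncomputable section

namespace DiagProd

universe u v

/-! ### Traces and characters of a group -/

section Traces

variable {G : Type u} [Group G]

/-- A trace on `G`: a positive-definite, normalized, conjugation-invariant function `G → ℂ`.
In `ℂ`, `0 ≤ z` means that `z` is a non-negative real number. -/
structure IsTrace (φ : G → ℂ) : Prop where
  posDef : ∀ (n : ℕ) (g : Fin n → G) (α : Fin n → ℂ),
    0 ≤ ∑ i, ∑ j, α i * (starRingEnd ℂ) (α j) * φ ((g j)⁻¹ * g i)
  normalized : φ 1 = 1
  conjInvariant : ∀ g h : G, φ (h⁻¹ * g * h) = φ g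

variable (G) in
/-- The space of traces on `G`, inside `G → ℂ` with the topology of pointwise convergence. -/
def Tr : Set (G → ℂ) := {φ | IsTrace φ}

variable (G) in
/-- The characters of `G`: the extreme points of the convex set of traces. -/
def Ch : Set (G → ℂ) := (Tr G).extremePoints ℝ

end Traces

/-- The linear map `f` restricts to a homeomorphism of `A` onto `B` (which is then affine on
convex subsets of `A`, being the restriction of a linear map). -/
def RestrictsToHomeomorph {X Y : Type*} [AddCommGroup X] [Module ℂ X] [TopologicalSpace X]
    [AddCommGroup Y] [Module ℂ Y] [TopologicalSpace Y]
    (f : X →ₗ[ℂ] Y) (A : Set X) (B : Set Y) : Prop :=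
  ∃ F : A ≃ₜ B, ∀ x : A, (F x : Y) = f x

/-! ### LEF approximations and diagonal products -/

section Diagonal

variable {G : Type u} [Group G] {H : ℕ → Type v} [∀ n, Group (H n)]

/-- `θ n : G → H n` is a LEF approximation: the groups `H n` are finite, the maps are eventually
multiplicative on each pair of elements, and eventually non-trivial on each `g ≠ 1`. -/
structure IsLEFApprox (θ : ∀ n, G → H n) : Prop where
  finite : ∀ n, Finite (H n)
  eventually_mul : ∀ g h : G, ∀ᶠ n in atTop, θ n (g * h) = θ n g * θ n h
  eventually_ne_one : ∀ g : G, g ≠ 1 → ∀ᶠ n in atTop, θ n g ≠ 1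

/-- The additional conditions for a LEF approximation to be essential and by simple groups, with
respect to the generating set `S`. -/
structure IsEssentialBySimple (S : Set G) (θ : ∀ n, G → H n) : Prop where
  simple : ∀ n, IsSimpleGroup (H n)
  pairwise_not_iso : ∀ m n, m ≠ n → IsEmpty (H m ≃* H n)
  not_extend : ∀ n, ¬ ∃ f : G →* H n, ∀ s ∈ S, f s = θ n s
  generates : ∀ n, Subgroup.closure (θ n '' S) = ⊤

/-- The diagonal product: the subgroup of `∏ H n` generated by the elements `(θ n s)_n`, `s ∈ S`. -/
def diagonalProduct (S : Set G) (θ : ∀ n, G → H n) : Subgroup (∀ n, H n) :=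
  Subgroup.closure ((fun s n => θ n s) '' S)

variable (H) in
/-- The direct sum `⊕ H n`, as a subgroup of the direct product `∏ H n`. -/
def directSum : Subgroup (∀ n, H n) where
  carrier := {f | {n | f n ≠ 1}.Finite}
  one_mem' := by simp
  mul_mem' {a b} ha hb := by
    refine (Set.Finite.union ha hb).subset fun n hn => ?_
    by_contra h
    have h1 : a n = 1 := by
      by_contra h'
      exact h (Or.inl h')
    have h2 : b n = 1 := by
      by_contra h'
      exact h (Or.inr h')
    exact hn (by simp [h1, h2])
  inv_mem' {a} ha := by simpa using ha

/-- The direct sum `⊕ H n`, seen as a subgroup of the diagonal product. -/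
def sumSubgroup (S : Set G) (θ : ∀ n, G → H n) : Subgroup (diagonalProduct S θ) :=
  (directSum H).subgroupOf (diagonalProduct S θ)

namespace IsLEFApprox

variable {θ : ∀ n, G → H n}

theorem eventually_one (hθ : IsLEFApprox θ) : ∀ᶠ n in atTop, θ n 1 = 1 := by
  filter_upwards [hθ.eventually_mul 1 1] with n hn
  simpa using hn

theorem eventually_inv (hθ : IsLEFApprox θ) (g : G) :
    ∀ᶠ n in atTop, θ n g⁻¹ = (θ n g)⁻¹ := by
  filter_upwards [hθ.eventually_mul g⁻¹ g, hθ.eventually_one] with n hn h1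
  rw [inv_mul_cancel, h1] at hn
  exact eq_inv_of_mul_eq_one_left hn.symm

theorem eq_of_eventually_eq (hθ : IsLEFApprox θ) {g h : G}
    (e : ∀ᶠ n in atTop, θ n g = θ n h) : g = h := by
  by_contra hne
  have h1 : g * h⁻¹ ≠ 1 := fun h' => hne (mul_inv_eq_one.mp h')
  obtain ⟨n, hn1, hn2, hn3, hn4⟩ := (e.and ((hθ.eventually_ne_one _ h1).and
    ((hθ.eventually_mul g h⁻¹).and (hθ.eventually_inv h)))).exists
  exact hn2 (by rw [hn3, hn4, hn1, mul_inv_cancel])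

theorem exists_tail (hθ : IsLEFApprox θ) (S : Set G) (γ : diagonalProduct S θ) :
    ∃ g : G, ∀ᶠ n in atTop, (γ : ∀ n, H n) n = θ n g := by
  obtain ⟨γ, hγ⟩ := γ
  induction hγ using Subgroup.closure_induction with
  | mem x hx =>
    obtain ⟨s, -, rfl⟩ := hx
    exact ⟨s, Eventually.of_forall fun _ => rfl⟩
  | one =>
    refine ⟨1, ?_⟩
    filter_upwards [hθ.eventually_one] with n hn
    simp [hn]
  | mul x y _ _ hx hy =>
    obtain ⟨g, hg⟩ := hx
    obtain ⟨h, hh⟩ := hy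
    refine ⟨g * h, ?_⟩
    filter_upwards [hg, hh, hθ.eventually_mul g h] with n h1 h2 h3
    simp [h1, h2, h3]
  | inv x _ hx =>
    obtain ⟨g, hg⟩ := hx
    refine ⟨g⁻¹, ?_⟩
    filter_upwards [hg, hθ.eventually_inv g] with n h1 h2
    simp [h1, h2]

/-- The tail map `t : ⊗ H n → G`: it sends `γ` to the unique `g ∈ G` such that `γ n = θ n g` for
all sufficiently large `n`. It is the homomorphism with `t ((θ n s)_n) = s` for all `s ∈ S`. -/
def tailMap (hθ : IsLEFApprox θ) (S : Set G) : diagonalProduct S θ →* G where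
  toFun γ := (hθ.exists_tail S γ).choose
  map_one' := by
    refine hθ.eq_of_eventually_eq ?_
    filter_upwards [(hθ.exists_tail S 1).choose_spec, hθ.eventually_one] with n h1 h2
    rw [← h1, h2]
    rfl
  map_mul' x y := by
    refine hθ.eq_of_eventually_eq ?_
    filter_upwards [(hθ.exists_tail S (x * y)).choose_spec, (hθ.exists_tail S x).choose_spec,
      (hθ.exists_tail S y).choose_spec, hθ.eventually_mul (hθ.exists_tail S x).choose
      (hθ.exists_tail S y).choose] with n h1 h2 h3 h4
    rw [← h1, h4, ← h2, ← h3]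
    rfl

theorem tailMap_spec (hθ : IsLEFApprox θ) (S : Set G) (γ : diagonalProduct S θ) :
    ∀ᶠ n in atTop, (γ : ∀ n, H n) n = θ n (hθ.tailMap S γ) :=
  (hθ.exists_tail S γ).choose_spec

theorem tailMap_generator (hθ : IsLEFApprox θ) (S : Set G) {s : G} (hs : s ∈ S) :
    hθ.tailMap S ⟨fun n => θ n s, Subgroup.subset_closure ⟨s, hs, rfl⟩⟩ = s :=
  (hθ.eq_of_eventually_eq (hθ.tailMap_spec S
    ⟨fun n => θ n s, Subgroup.subset_closure ⟨s, hs, rfl⟩⟩)).symm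

end IsLEFApprox

/-! ### Tensor products, compatible traces and compatible characters -/

variable (S : Set G) (θ : ∀ n, G → H n)

/-- The tensor product `⊗ φ n` on `U = ⊕ H n`: the function `u ↦ ∏ n, φ n (u n)`. When `φ n 1 = 1`
for all `n`, all but finitely many factors are equal to `1`. -/
def tensor (φ : ∀ n, H n → ℂ) : sumSubgroup S θ → ℂ :=
  fun u => ∏ᶠ n, φ n (((u : diagonalProduct S θ) : ∀ n, H n) n)

/-- The function `γ ↦ ∏ i < n, φ i (γ i)` on the diagonal product. -/
def partialTensor (φ : ∀ n, H n → ℂ) (n : ℕ) : diagonalProduct S θ → ℂ :=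
  fun γ => ∏ i ∈ Finset.range n, φ i ((γ : ∀ n, H n) i)

/-- `φhat` is an accumulation point, for pointwise convergence, of the sequence of functions
`γ ↦ ∏ i < n, φ i (γ i)`. -/
def IsAuxiliary (φ : ∀ n, H n → ℂ) (φhat : diagonalProduct S θ → ℂ) : Prop :=
  MapClusterPt φhat atTop (partialTensor S θ φ)

/-- The traces on the diagonal product whose restriction to `U = ⊕ H n` is `⊗ φ n`. -/
def tracesOver (φ : ∀ n, H n → ℂ) : Set (diagonalProduct S θ → ℂ) :=
  {ζ | ζ ∈ Tr (diagonalProduct S θ) ∧ (fun u : sumSubgroup S θ => ζ u) = tensor S θ φ}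

variable {θ}

/-- `τ ∈ G` is null for `φ` if the infinite product `∏ |φ i (γ i)|` (the limit of its partial
products) is `0` for every `γ` in the diagonal product with tail `τ`. -/
def IsNull (hθ : IsLEFApprox θ) (φ : ∀ n, H n → ℂ) (τ : G) : Prop :=
  ∀ γ : diagonalProduct S θ, hθ.tailMap S γ = τ →
    Tendsto (fun n => ∏ i ∈ Finset.range n, ‖φ i ((γ : ∀ n, H n) i)‖) atTop (𝓝 0)

/-- The traces on `G` that are compatible with `φ`. -/
def compatibleTraces (hθ : IsLEFApprox θ) (φ : ∀ n, H n → ℂ) : Set (G → ℂ) :=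
  {ψ | ψ ∈ Tr G ∧ ∀ τ, IsNull S hθ φ τ → ψ τ = 0}

/-- The compatible characters for `φ`: the extreme points of the set of compatible traces. -/
def compatibleCharacters (hθ : IsLEFApprox θ) (φ : ∀ n, H n → ℂ) : Set (G → ℂ) :=
  (compatibleTraces S hθ φ).extremePoints ℝ

/-- The linear map `ψ ↦ φhat · (ψ ∘ t)`. -/
def twist (hθ : IsLEFApprox θ) (φhat : diagonalProduct S θ → ℂ) :
    (G → ℂ) →ₗ[ℂ] (diagonalProduct S θ → ℂ) where
  toFun ψ := fun γ => φhat γ * ψ (hθ.tailMap S γ)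
  map_add' ψ₁ ψ₂ := by
    funext γ
    simp [mul_add]
  map_smul' c ψ := by
    funext γ
    simp [mul_left_comm]

end Diagonal

end DiagProd

end

/-!
Goursat: an element of `Γ ∩ ⊕ H n` of minimal support among those with a non-trivial `n`-th
coordinate is supported at `n`, since two of its coordinates would otherwise be related by an
isomorphism `H m ≃* H n`; as the `H n` are simple, this gives `⊕ H n ≤ Γ`.

A trace that restricts to a character on a subgroup is multiplicative on products of an element of
that subgroup with an element commuting with the whole subgroup. Hence a trace `ζ` over `⊗ φ n`
satisfies `ζ γ = (∏ i < n, φ i (γ i)) * ζ γₙ`, where `γₙ` is obtained from `γ` by replacing the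
first `n` coordinates by `1`. The same holds for an auxiliary trace `φhat`, and letting `n → ∞` one
sees that `‖ζ‖ ≤ ‖φhat‖` and that, off the zeros of `φhat`, the quotient `ζ / φhat` at `γ` is the
limit of `ζ * conj φhat` at `γₙ`. Any cluster point of the traces `γ ↦ (ζ * conj φhat) γₙ` depends
only on the tail of `γ`, so it comes from a trace on `G`, and this is the compatible trace sought.
Since the traces over `⊗ φ n` form a face of the set of all traces, extreme points correspond to
extreme points.
-/

open Filter Topology
open scoped ComplexOrder

noncomputable section

namespace DiagProd

/-! ### Positive-definite functions -/

section PosDef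

variable {G : Type*} [Group G] {f f₁ f₂ : G → ℂ}

/-- The Gram matrix `(h, g) ↦ f (h⁻¹ g)` of a function on a group. -/
def gram (f : G → ℂ) : Matrix G G ℂ := .of fun h g => f (h⁻¹ * g)

/-- Positive-definite functions, defined through their Gram matrix in order to have the closure
properties of positive semidefinite matrices at hand. -/
def IsPosDef (f : G → ℂ) : Prop := (gram f).PosSemidef

theorem isPosDef_of_sum_nonneg
    (hf : ∀ (n : ℕ) (g : Fin n → G) (α : Fin n → ℂ),
      0 ≤ ∑ i, ∑ j, α i * (starRingEnd ℂ) (α j) * f ((g j)⁻¹ * g i)) : IsPosDef f := by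
  refine ⟨Matrix.IsHermitian.ext fun h g => ?_, fun x => ?_⟩
  · -- polarization: the quadratic form is real on the pairs `(1, 1)` and `(1, I)`
    have h₁ := (Complex.nonneg_iff.mp (hf 1 ![1] ![1])).2
    have h₂ := (Complex.nonneg_iff.mp (hf 2 ![h, g] ![1, 1])).2
    have h₃ := (Complex.nonneg_iff.mp (hf 2 ![h, g] ![1, Complex.I])).2
    simp only [Finset.univ_unique, Fin.default_eq_zero, Matrix.cons_val_fin_one, map_one, mul_one,
      inv_one, one_mul, Finset.sum_const, Finset.card_singleton, one_smul, Fin.sum_univ_two,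
      Matrix.cons_val_zero, Matrix.cons_val_one, inv_mul_cancel, Complex.add_im, Complex.conj_I,
      mul_neg, neg_mul, Complex.I_mul_I, neg_neg, Complex.neg_im, Complex.mul_im, Complex.I_re,
      zero_mul, Complex.I_im, zero_add] at h₁ h₂ h₃
    apply Complex.ext <;> simp [gram] <;> linarith
  · let e := x.support.equivFin
    convert hf _ (fun i => e.symm i) (fun i => x (e.symm i)) using 1
    rw [e.symm.sum_comp fun i => ∑ j, x i * (starRingEnd ℂ) (x (e.symm j)) *
      f ((e.symm j : G)⁻¹ * i)]
    simp_rw [fun i => e.symm.sum_comp fun j => x i * (starRingEnd ℂ) (x j) * f ((j : G)⁻¹ * i)]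
    rw [Finset.sum_comm]
    simp only [Finsupp.sum, ← Finset.sum_coe_sort x.support, gram, Matrix.of_apply,
      Complex.star_def]
    exact Finset.sum_congr rfl fun i _ => Finset.sum_congr rfl fun j _ => by ring

namespace IsPosDef

theorem sum_nonneg (hf : IsPosDef f) {ι : Type*} [Fintype ι] (g : ι → G) (α : ι → ℂ) :
    0 ≤ ∑ i, ∑ j, α i * (starRingEnd ℂ) (α j) * f ((g j)⁻¹ * g i) := by
  convert (Matrix.PosSemidef.submatrix hf g).dotProduct_mulVec_nonneg α using 1
  simp only [dotProduct, Matrix.mulVec, Finset.mul_sum]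
  rw [Finset.sum_comm]
  refine Finset.sum_congr rfl fun i _ => Finset.sum_congr rfl fun j _ => ?_
  simp only [gram, Matrix.submatrix_apply, Matrix.of_apply, Pi.star_apply, Complex.star_def]
  ring

theorem one_nonneg (hf : IsPosDef f) : 0 ≤ f 1 := by
  simpa [gram] using Matrix.PosSemidef.diag_nonneg hf (i := 1)

theorem map_inv (hf : IsPosDef f) (g : G) : f g⁻¹ = (starRingEnd ℂ) (f g) := by
  simpa [gram] using (Matrix.IsHermitian.apply hf.1 g 1).symm

theorem norm_le (hf : IsPosDef f) (g : G) : ‖f g‖ ≤ ‖f 1‖ := by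
  have hdet : 0 ≤ f 1 * f 1 - f g * f g⁻¹ := by
    have := (Matrix.PosSemidef.submatrix hf ![1, g]).det_nonneg
    rw [Matrix.det_fin_two] at this
    simpa [gram] using this
  rw [Complex.eq_coe_norm_of_nonneg hf.one_nonneg, hf.map_inv, Complex.mul_conj',
    ← sq, sub_nonneg] at hdet
  exact (sq_le_sq₀ (norm_nonneg _) (norm_nonneg _)).mp (by exact_mod_cast hdet)

theorem mul (h₁ : IsPosDef f₁) (h₂ : IsPosDef f₂) : IsPosDef (f₁ * f₂) :=
  Matrix.PosSemidef.hadamard h₁ h₂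

theorem add (h₁ : IsPosDef f₁) (h₂ : IsPosDef f₂) : IsPosDef (f₁ + f₂) :=
  Matrix.PosSemidef.add h₁ h₂

theorem smul (hf : IsPosDef f) {c : ℝ} (hc : 0 ≤ c) : IsPosDef (c • f) :=
  Matrix.PosSemidef.smul hf hc

theorem conj (hf : IsPosDef f) : IsPosDef (star f) := by
  have : gram (star f) = (gram f).transpose := by
    ext h g
    simpa [gram] using (hf.map_inv (h⁻¹ * g)).symm
  rw [IsPosDef, this]
  exact Matrix.PosSemidef.transpose hf

theorem comp {K : Type*} [Group K] (hf : IsPosDef f) (ι : K →* G) : IsPosDef (f ∘ ι) := by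
  have : gram (f ∘ ι) = (gram f).submatrix ι ι := by
    ext h g
    simp [gram]
  rw [IsPosDef, this]
  exact Matrix.PosSemidef.submatrix hf ι

end IsPosDef

theorem isPosDef_one : IsPosDef (1 : G → ℂ) :=
  isPosDef_of_sum_nonneg fun n _ α => by
    simpa [← Finset.mul_sum, ← Finset.sum_mul] using mul_star_self_nonneg (∑ i, α i)

theorem mulVec_eq_zero_of_add_mulVec_eq_zero {K : Type*} [Fintype K] {A B : Matrix K K ℂ}
    (hA : A.PosSemidef) (hB : B.PosSemidef) {v : K → ℂ} (h : (A + B).mulVec v = 0) :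
    A.mulVec v = 0 := by
  have hsum : star v ⬝ᵥ A.mulVec v + star v ⬝ᵥ B.mulVec v = 0 := by
    rw [← dotProduct_add, ← Matrix.add_mulVec, h, dotProduct_zero]
  refine (hA.dotProduct_mulVec_zero_iff v).mp ?_
  exact ((add_eq_zero_iff_of_nonneg (hA.dotProduct_mulVec_nonneg v)
    (hB.dotProduct_mulVec_nonneg v)).mp hsum).1

end PosDef

/-! ### Traces -/

section Traces

variable {G : Type*} [Group G] {f f₁ f₂ : G → ℂ}

/-- Functions that are constant on conjugacy classes. -/
def IsClassFunction (f : G → ℂ) : Prop := ∀ g h : G, f (h⁻¹ * g * h) = f g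

theorem isTrace_iff : IsTrace f ↔ IsPosDef f ∧ f 1 = 1 ∧ IsClassFunction f :=
  ⟨fun h => ⟨isPosDef_of_sum_nonneg h.posDef, h.normalized, h.conjInvariant⟩,
    fun h => ⟨fun _ => h.1.sum_nonneg, h.2.1, h.2.2⟩⟩

namespace IsTrace

theorem isPosDef (hf : IsTrace f) : IsPosDef f := (isTrace_iff.mp hf).1

theorem norm_le_one (hf : IsTrace f) (g : G) : ‖f g‖ ≤ 1 := by
  simpa [hf.normalized] using hf.isPosDef.norm_le g

theorem map_mul_comm (hf : IsTrace f) (g h : G) : f (g * h) = f (h * g) := by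
  simpa [mul_assoc] using (hf.conjInvariant (g * h) g).symm

theorem one : IsTrace (1 : G → ℂ) :=
  isTrace_iff.mpr ⟨isPosDef_one, rfl, fun _ _ => rfl⟩

theorem mul (h₁ : IsTrace f₁) (h₂ : IsTrace f₂) : IsTrace (f₁ * f₂) :=
  isTrace_iff.mpr ⟨h₁.isPosDef.mul h₂.isPosDef, by simp [h₁.normalized, h₂.normalized],
    fun g h => by simp [h₁.conjInvariant, h₂.conjInvariant]⟩

theorem conj (hf : IsTrace f) : IsTrace (star f) :=
  isTrace_iff.mpr ⟨hf.isPosDef.conj, by simp [hf.normalized],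
    fun g h => by simp [hf.conjInvariant]⟩

theorem comp {K : Type*} [Group K] (hf : IsTrace f) (ι : K →* G) : IsTrace (f ∘ ι) :=
  isTrace_iff.mpr ⟨hf.isPosDef.comp ι, by simp [hf.normalized],
    fun g h => by simp [hf.conjInvariant]⟩

theorem of_comp_surjective {W : Type*} [Group W] {t : W →* G} (ht : Function.Surjective t)
    (hf : IsTrace (f ∘ t)) : IsTrace f where
  posDef n g α := by
    choose s hs using ht
    simpa [hs] using hf.posDef n (s ∘ g) α
  normalized := by simpa using hf.normalized
  conjInvariant := ht.forall₂.mpr fun g h => by simpa using hf.conjInvariant g h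

theorem prod {ι : Type*} (s : Finset ι) {f : ι → G → ℂ} (hf : ∀ i ∈ s, IsTrace (f i)) :
    IsTrace (∏ i ∈ s, f i) :=
  Finset.prod_induction f IsTrace (fun _ _ => mul) one hf

end IsTrace

theorem convex_Tr : Convex ℝ (Tr G) := by
  intro a ha b hb s t hs ht hst
  refine isTrace_iff.mpr ⟨(ha.isPosDef.smul hs).add (hb.isPosDef.smul ht), ?_, fun g h => ?_⟩
  · simpa [ha.normalized, hb.normalized] using mod_cast hst
  · simp [ha.conjInvariant, hb.conjInvariant]

theorem isClosed_Tr : IsClosed (Tr G) := by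
  have : Tr G = (⋂ (n : ℕ) (g : Fin n → G) (α : Fin n → ℂ),
      {φ | 0 ≤ ∑ i, ∑ j, α i * (starRingEnd ℂ) (α j) * φ ((g j)⁻¹ * g i)}) ∩
      ({φ | φ 1 = 1} ∩ ⋂ (g : G) (h : G), {φ | φ (h⁻¹ * g * h) = φ g}) := by
    ext φ
    simp only [Set.mem_inter_iff, Set.mem_iInter]
    exact ⟨fun h => ⟨h.posDef, h.normalized, h.conjInvariant⟩, fun h => ⟨h.1, h.2.1, h.2.2⟩⟩
  rw [this]
  refine .inter (isClosed_iInter fun n => isClosed_iInter fun g => isClosed_iInter fun α => ?_)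
    (.inter ?_ (isClosed_iInter fun g => isClosed_iInter fun h => ?_))
  · exact isClosed_le continuous_const (by fun_prop)
  · exact isClosed_eq (by fun_prop) continuous_const
  · exact isClosed_eq (by fun_prop) (by fun_prop)

theorem isCompact_Tr : IsCompact (Tr G) := by
  refine (isCompact_univ_pi fun _ : G => isCompact_closedBall (0 : ℂ) 1).of_isClosed_subset
    isClosed_Tr fun φ hφ g _ => ?_
  simpa using IsTrace.norm_le_one hφ g

theorem isTrace_of_mem_Ch (hf : f ∈ Ch G) : IsTrace f := extremePoints_subset hf

end Traces

/-! ### Extremality and multiplicativity -/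

section Extremality

variable {G : Type*} [Group G]

theorem IsPosDef.exists_eq_smul_trace {f : G → ℂ} (hf : IsPosDef f) (hc : IsClassFunction f) :
    ∃ a ∈ Tr G, f = ‖f 1‖ • a := by
  rcases eq_or_ne (f 1) 0 with h₁ | h₁
  · refine ⟨1, IsTrace.one, funext fun g => ?_⟩
    simpa [h₁] using hf.norm_le g
  · have hn : ‖f 1‖ ≠ 0 := norm_ne_zero_iff.mpr h₁
    have h₁' : (‖f 1‖⁻¹ : ℂ) * f 1 = 1 := by
      rw [← Complex.eq_coe_norm_of_nonneg hf.one_nonneg, inv_mul_cancel₀ h₁]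
    refine ⟨‖f 1‖⁻¹ • f, isTrace_iff.mpr ⟨hf.smul (by positivity), by simpa using h₁',
      fun g h => ?_⟩, (smul_inv_smul₀ hn f).symm⟩
    simp only [Pi.smul_apply, hc g h]

theorem eq_smul_of_add_eq_smul_character {ζ f₁ f₂ : G → ℂ} (hζ : ζ ∈ Ch G)
    (h₁ : IsPosDef f₁) (h₂ : IsPosDef f₂) (hc₁ : IsClassFunction f₁) (hc₂ : IsClassFunction f₂)
    {c : ℝ} (hadd : f₁ + f₂ = c • ζ) : f₁ = f₁ 1 • ζ := by
  obtain ⟨a, ha, hfa⟩ := h₁.exists_eq_smul_trace hc₁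
  obtain ⟨b, hb, hfb⟩ := h₂.exists_eq_smul_trace hc₂
  generalize hs : ‖f₁ 1‖ = s at hfa
  generalize ht : ‖f₂ 1‖ = t at hfb
  have hs₀ : 0 ≤ s := hs ▸ norm_nonneg _
  have ht₀ : 0 ≤ t := ht ▸ norm_nonneg _
  subst hfa hfb
  have hst : s + t = c := by
    have := congrFun hadd 1
    simp only [Pi.add_apply, Pi.smul_apply, ha.normalized, hb.normalized,
      (isTrace_of_mem_Ch hζ).normalized, Complex.real_smul, mul_one] at this
    exact_mod_cast this
  suffices h : s • a = s • ζ by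
    funext g
    simpa [ha.normalized] using congrFun h g
  rcases hs₀.eq_or_lt with rfl | hs_pos
  · simp
  have hc : 0 < c := by linarith
  have hseg : ζ ∈ segment ℝ a b := by
    refine ⟨s / c, t / c, by positivity, by positivity, by rw [← add_div, hst, div_self hc.ne'], ?_⟩
    rw [div_eq_inv_mul, div_eq_inv_mul, mul_smul, mul_smul, ← smul_add, hadd,
      inv_smul_smul₀ hc.ne']
  rcases (mem_extremePoints_iff_forall_segment.mp hζ).2 a ha b hb hseg with rfl | rfl
  · rfl
  · rwa [← hst, add_smul, add_left_inj] at hadd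

/-- A class function that may be added to `c • φ` with any phase `ω` without destroying positivity
is a multiple of `φ`. -/
theorem eq_smul_of_isPosDef_perturbation {φ F : G → ℂ} (hφ : φ ∈ Ch G) (hF : IsClassFunction F)
    {c : ℝ} (hpos : ∀ ω : ℂ, ‖ω‖ = 1 → IsPosDef fun g =>
      c * φ g + ω * F g + (starRingEnd ℂ) ω * (starRingEnd ℂ) (F g⁻¹)) : F = F 1 • φ := by
  set P : ℂ → G → ℂ := fun ω g =>
    c * φ g + ω * F g + (starRingEnd ℂ) ω * (starRingEnd ℂ) (F g⁻¹) with hP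
  have hφT := isTrace_of_mem_Ch hφ
  have hclass : ∀ ω, IsClassFunction (P ω) := fun ω g h => by
    have hinv : (h⁻¹ * g * h)⁻¹ = h⁻¹ * g⁻¹ * h := by group
    simp only [hP, hφT.conjInvariant, hF g h, hinv, hF g⁻¹ h]
  have hmul : ∀ ω, ‖ω‖ = 1 → P ω = P ω 1 • φ := fun ω hω => by
    refine eq_smul_of_add_eq_smul_character hφ (hpos ω hω) (hpos (-ω) (by simpa using hω))
      (hclass ω) (hclass (-ω)) (c := 2 * c) (funext fun g => ?_)
    simp only [Pi.add_apply, Pi.smul_apply, Complex.real_smul, map_neg]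
    push_cast
    ring
  funext g
  have hre := congrFun (hmul 1 (by simp)) g
  have him := congrFun (hmul Complex.I (by simp)) g
  simp only [hP, Pi.smul_apply, smul_eq_mul, hφT.normalized, inv_one, map_one, one_mul, mul_one,
    Complex.conj_I] at hre him
  rw [Pi.smul_apply, smul_eq_mul]
  linear_combination hre / 2 - Complex.I / 2 * him +
    (F g - (starRingEnd ℂ) (F g⁻¹) - (F 1 - (starRingEnd ℂ) (F 1)) * φ g) / 2 * Complex.I_mul_I

/-- Positivity of `(1 + ω x)⋆ (1 + ω x)`. -/
theorem IsPosDef.sum_add_phase_nonneg {f : G → ℂ} (hf : IsPosDef f) (x : G) {ω : ℂ}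
    (hω : ‖ω‖ = 1) {J : Type*} [Fintype J] (g : J → G) (α : J → ℂ) :
    0 ≤ ∑ i, ∑ j, α i * (starRingEnd ℂ) (α j) * (2 * f ((g j)⁻¹ * g i) +
      ω * f ((g j)⁻¹ * x * g i) +
      (starRingEnd ℂ) ω * (starRingEnd ℂ) (f ((g i)⁻¹ * x * g j))) := by
  have hω' : ω * (starRingEnd ℂ) ω = 1 := by simp [Complex.mul_conj', hω]
  convert hf.sum_nonneg (Sum.elim g fun i => x * g i) (Sum.elim α fun i => ω * α i) using 1
  simp only [Fintype.sum_sum_type, Sum.elim_inl, Sum.elim_inr, ← Finset.sum_add_distrib,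
    ← hf.map_inv]
  refine Finset.sum_congr rfl fun i _ => Finset.sum_congr rfl fun j _ => ?_
  simp only [map_mul, mul_inv_rev, mul_assoc, inv_mul_cancel_left, inv_inv]
  linear_combination (-α i * (starRingEnd ℂ) (α j) * f ((g j)⁻¹ * g i)) * hω'

section Permuted

variable {K J : Type*} [Group K] [Fintype J] {ι : K →* G} {c : J → G}

theorem sum_conj_mul_of_permuted (hc : ∀ k, ∃ σ : Equiv.Perm J, ∀ j, (ι k)⁻¹ * c j * ι k = c (σ j))
    (ζ : G → ℂ) (h g : K) :
    ∑ j, ζ ((ι h)⁻¹ * c j * ι g) = ∑ j, ζ (c j * ι (h⁻¹ * g)) := by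
  obtain ⟨σ, hσ⟩ := hc h
  rw [← Equiv.sum_comp σ fun j => ζ (c j * ι (h⁻¹ * g))]
  refine Finset.sum_congr rfl fun j _ => ?_
  rw [← hσ, map_mul, map_inv]
  group

/-- A family permuted by conjugation is central for `K` in the group algebra, and a character is
multiplicative with respect to central elements. -/
theorem IsTrace.sum_mul_of_permuted {ζ : G → ℂ} (hζ : IsTrace ζ) (hι : ζ ∘ ι ∈ Ch K)
    (hc : ∀ k, ∃ σ : Equiv.Perm J, ∀ j, (ι k)⁻¹ * c j * ι k = c (σ j)) (x : K) :
    ∑ j, ζ (c j * ι x) = (∑ j, ζ (c j)) * ζ (ι x) := by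
  have hsum := sum_conj_mul_of_permuted hc ζ
  have hclass : IsClassFunction fun k => ∑ j, ζ (c j * ι k) := fun k h => by
    beta_reduce
    rw [mul_assoc, ← hsum]
    refine Finset.sum_congr rfl fun j _ => ?_
    rw [map_mul, ← hζ.conjInvariant (c j * ι k) (ι h)]
    simp only [mul_assoc]
  have hpos : ∀ ω : ℂ, ‖ω‖ = 1 → IsPosDef fun k => (2 * Fintype.card J : ℝ) * (ζ ∘ ι) k +
      ω * ∑ j, ζ (c j * ι k) +
      (starRingEnd ℂ) ω * (starRingEnd ℂ) (∑ j, ζ (c j * ι k⁻¹)) := fun ω hω =>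
    isPosDef_of_sum_nonneg fun n g α => by
      convert Finset.sum_nonneg fun (j : J) (_ : j ∈ Finset.univ) =>
        hζ.isPosDef.sum_add_phase_nonneg (c j) hω (ι ∘ g) α using 1
      rw [Finset.sum_comm]
      simp_rw [Finset.sum_comm (s := Finset.univ (α := J))]
      rw [Finset.sum_comm]
      refine Finset.sum_congr rfl fun a _ => Finset.sum_congr rfl fun b _ => ?_
      simp only [Function.comp_apply, ← Finset.mul_sum, Finset.sum_add_distrib, hsum, ← map_sum,
        mul_inv_rev, inv_inv, Finset.sum_const, Finset.card_univ, nsmul_eq_mul, map_mul, map_inv]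
      push_cast
      ring
  simpa using congrFun (eq_smul_of_isPosDef_perturbation hι hclass hpos) x

end Permuted

theorem IsTrace.map_mul_of_commute {K : Type*} [Group K] {ζ : G → ℂ} (hζ : IsTrace ζ) {ι : K →* G}
    (hι : ζ ∘ ι ∈ Ch K) (x : K) {g : G} (hg : ∀ k, Commute (ι k) g) :
    ζ (ι x * g) = ζ (ι x) * ζ g := by
  have := hζ.sum_mul_of_permuted hι (c := fun _ : Unit => g)
    (fun k => ⟨1, fun _ => by rw [mul_assoc, ← (hg k).eq, inv_mul_cancel_left]⟩) x
  simpa [(hg x).eq, mul_comm] using this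

end Extremality

/-! ### Characters of finite groups -/

section FiniteGroup

variable {K : Type*} [Group K] [Fintype K]

theorem sum_conj_mul_of_inner {G : Type*} [Group G] {ζ : G → ℂ} (hζ : ζ ∈ Ch G) {ι : K →* G}
    (hι : ∀ g, ∃ k, ∀ x, g⁻¹ * ι x * g = ι (k⁻¹ * x * k)) (x : K) (g : G) :
    ∑ k : K, ζ (ι (k⁻¹ * x * k) * g) = Fintype.card K * ζ (ι x) * ζ g := by
  have hζT := isTrace_of_mem_Ch hζ
  have := hζT.sum_mul_of_permuted (ι := MonoidHom.id G) hζ (c := fun k : K => ι (k⁻¹ * x * k))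
    (fun g => by
      obtain ⟨k₀, hk₀⟩ := hι g
      refine ⟨Equiv.mulRight k₀, fun k => ?_⟩
      rw [MonoidHom.id_apply, hk₀]
      simp [mul_assoc]) g
  simpa [hζT.conjInvariant] using this

/-- The element `∑ k, k⁻¹ x k - |K| c` of the group algebra of `K`, which the Gram matrix of a
character `φ` with `φ x = c` annihilates. -/
def shiftedClassSum [DecidableEq K] (x : K) (c : ℂ) : K → ℂ :=
  ∑ k, Pi.single (k⁻¹ * x * k) 1 - Pi.single 1 (Fintype.card K * c)

theorem gram_mulVec_shiftedClassSum [DecidableEq K] (f : K → ℂ) (x : K) (c : ℂ) (h : K) :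
    (gram f).mulVec (shiftedClassSum x c) h =
      ∑ k, f (h⁻¹ * (k⁻¹ * x * k)) - Fintype.card K * c * f h⁻¹ := by
  simp [shiftedClassSum, Matrix.mulVec_sub, Matrix.mulVec_sum, gram, mul_comm]

/-- By hypothesis the Gram matrix of `φ` kills the elements `∑ k, k⁻¹ x k - |K| φ x`; hence so does
the Gram matrix of every trace `a` in a convex decomposition of `φ`, and this forces `a x = φ x`. -/
theorem mem_Ch_of_sum_conj_mul {φ : K → ℂ} (hφ : φ ∈ Tr K)
    (hmul : ∀ x y, ∑ k : K, φ (k⁻¹ * x * k * y) = Fintype.card K * φ x * φ y) : φ ∈ Ch K := by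
  classical
  refine mem_extremePoints_iff_left.mpr ⟨hφ, fun a ha b hb hseg => funext fun x => ?_⟩
  obtain ⟨s, t, hs, ht, -, hab⟩ := hseg
  have hker : (gram φ).mulVec (shiftedClassSum x (φ x)) = 0 := funext fun h => by
    rw [gram_mulVec_shiftedClassSum, Pi.zero_apply, sub_eq_zero, ← hmul]
    exact Finset.sum_congr rfl fun k _ => hφ.map_mul_comm _ _
  have hgram : gram φ = gram (s • a) + gram (t • b) := by
    rw [← hab]
    rfl
  have hkera := congrFun (mulVec_eq_zero_of_add_mulVec_eq_zero (ha.isPosDef.smul hs.le)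
    (hb.isPosDef.smul ht.le) (hgram ▸ hker)) 1
  rw [gram_mulVec_shiftedClassSum] at hkera
  simp only [Pi.smul_apply, inv_one, one_mul, ha.conjInvariant x, ha.normalized, Finset.sum_const,
    Finset.card_univ, nsmul_eq_mul, Complex.real_smul, mul_one, Pi.zero_apply] at hkera
  refine mul_left_cancel₀ (mul_ne_zero (Nat.cast_ne_zero.mpr Fintype.card_ne_zero)
    (Complex.ofReal_ne_zero.mpr hs.ne') : (Fintype.card K * s : ℂ) ≠ 0) ?_
  linear_combination hkera

end FiniteGroup

theorem comp_mem_Ch_of_inner {K G : Type*} [Group K] [Finite K] [Group G] {ζ : G → ℂ}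
    (hζ : ζ ∈ Ch G) {ι : K →* G} (hι : ∀ g, ∃ k, ∀ x, g⁻¹ * ι x * g = ι (k⁻¹ * x * k)) :
    ζ ∘ ι ∈ Ch K := by
  have := Fintype.ofFinite K
  refine mem_Ch_of_sum_conj_mul ((isTrace_of_mem_Ch hζ).comp ι) fun x y => ?_
  simpa using sum_conj_mul_of_inner hζ hι x (ι y)

/-! ### Subdirect products of simple groups -/

theorem nonempty_mulEquiv_of_ker_le {K L M : Type*} [Group K] [Group L] [Group M]
    [IsSimpleGroup L] [Nontrivial M] {f : K →* L} {g : K →* M} (hf : Function.Surjective f)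
    (hg : Function.Surjective g) (hker : f.ker ≤ g.ker) : Nonempty (L ≃* M) := by
  obtain ⟨q, rfl⟩ : ∃ q : L →* M, q.comp f = g :=
    ⟨f.liftOfSurjective hf ⟨g, hker⟩, f.liftOfRightInverse_comp _ _ ⟨g, hker⟩⟩
  have hq : Function.Surjective q := .of_comp (by simpa using hg)
  have hq_ker : q.ker ≠ ⊤ := fun h => by
    obtain ⟨y, hy⟩ := exists_ne (1 : M)
    obtain ⟨x, rfl⟩ := hq y
    exact hy (MonoidHom.mem_ker.mp (h ▸ Subgroup.mem_top x))
  have hq_inj := (MonoidHom.ker_eq_bot_iff q).mp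
    (q.normal_ker.eq_bot_or_eq_top.resolve_right hq_ker)
  exact ⟨MulEquiv.ofBijective q ⟨hq_inj, hq⟩⟩

section Subdirect

variable {ι : Type*} {H : ι → Type*} [∀ i, Group (H i)] {D : Subgroup (∀ i, H i)}

/-- The elements of `D` whose coordinates outside `F` are trivial. -/
def supportedIn (D : Subgroup (∀ i, H i)) (F : Set ι) : Subgroup (∀ i, H i) :=
  D ⊓ Subgroup.pi Fᶜ fun _ => ⊥

theorem mem_supportedIn {F : Set ι} {w : ∀ i, H i} :
    w ∈ supportedIn D F ↔ w ∈ D ∧ ∀ i ∉ F, w i = 1 := by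
  simp [supportedIn, Subgroup.mem_inf, Subgroup.mem_pi]

theorem map_eval_supportedIn {n : ι} [IsSimpleGroup (H n)]
    (hD : D.map (Pi.evalMonoidHom H n) = ⊤) {F : Set ι} {w : ∀ i, H i}
    (hw : w ∈ supportedIn D F) (hwn : w n ≠ 1) :
    (supportedIn D F).map (Pi.evalMonoidHom H n) = ⊤ := by
  have hnormal : ((supportedIn D F).map (Pi.evalMonoidHom H n)).Normal := by
    refine ⟨?_⟩
    rintro _ ⟨x, hx, rfl⟩ h
    obtain ⟨δ, hδ, rfl⟩ := hD ▸ Subgroup.mem_top h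
    obtain ⟨hxD, hxF⟩ := mem_supportedIn.mp hx
    refine ⟨δ * x * δ⁻¹, mem_supportedIn.mpr ⟨mul_mem (mul_mem hδ hxD) (inv_mem hδ), ?_⟩, rfl⟩
    exact fun i hi => by simp [hxF i hi]
  refine hnormal.eq_bot_or_eq_top.resolve_left fun h => hwn ?_
  exact Subgroup.mem_bot.mp (h ▸ Subgroup.mem_map_of_mem (Pi.evalMonoidHom H n) hw)

/-- Goursat's argument: if `F` is a minimal finite support of an element with non-trivial `n`-th
coordinate and `n ≠ m ∈ F`, then on `supportedIn D F` the `m`-th coordinate determines the `n`-th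
one, so that `H m ≃* H n`. -/
theorem exists_mem_supportedIn_singleton [∀ i, IsSimpleGroup (H i)]
    (hiso : ∀ m n, m ≠ n → IsEmpty (H m ≃* H n)) (hD : ∀ n, D.map (Pi.evalMonoidHom H n) = ⊤)
    {n : ι} (hn : ∃ F : Finset ι, ∃ w ∈ supportedIn D F, w n ≠ 1) :
    ∃ w ∈ supportedIn D {n}, w n ≠ 1 := by
  classical
  obtain ⟨F, ⟨w, hw, hwn⟩, hmin⟩ := exists_minimal_of_wellFoundedLT _ hn
  have hker : ∀ m ∈ F, ∀ x ∈ supportedIn D F, x m = 1 → x n = 1 := by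
    intro m hm x hx hxm
    by_contra hxn
    obtain ⟨hxD, hxF⟩ := mem_supportedIn.mp hx
    refine Finset.notMem_erase m F
      (hmin ⟨x, mem_supportedIn.mpr ⟨hxD, fun i hi => ?_⟩, hxn⟩ (Finset.erase_subset m F) hm)
    rcases eq_or_ne i m with rfl | him
    · exact hxm
    · exact hxF i fun hiF => hi (Finset.mem_erase.mpr ⟨him, hiF⟩)
  have hsurj : ∀ m, w m ≠ 1 → Function.Surjective
      ((Pi.evalMonoidHom H m).comp (supportedIn D F).subtype) := fun m hm => by
    rw [← MonoidHom.range_eq_top, MonoidHom.range_comp, Subgroup.range_subtype]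
    exact map_eval_supportedIn (hD m) hw hm
  have hF : ∀ m ∈ F, m = n := fun m hm => by
    by_contra hmn
    refine not_isEmpty_iff.mpr ?_ (hiso m n hmn)
    exact nonempty_mulEquiv_of_ker_le (hsurj m fun h => hwn (hker m hm w hw h)) (hsurj n hwn)
      fun x hx => hker m hm x x.2 hx
  obtain ⟨hwD, hwF⟩ := mem_supportedIn.mp hw
  exact ⟨w, mem_supportedIn.mpr ⟨hwD, fun i hi => hwF i fun h => hi (hF i h)⟩, hwn⟩

theorem mulSingle_mem_of_subdirect [DecidableEq ι] [∀ i, IsSimpleGroup (H i)]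
    (hiso : ∀ m n, m ≠ n → IsEmpty (H m ≃* H n)) (hD : ∀ n, D.map (Pi.evalMonoidHom H n) = ⊤)
    {n : ι} (hn : ∃ F : Finset ι, ∃ w ∈ supportedIn D F, w n ≠ 1) (x : H n) :
    Pi.mulSingle n x ∈ D := by
  obtain ⟨v, hv, hvn⟩ := exists_mem_supportedIn_singleton hiso hD hn
  obtain ⟨w, hw, rfl⟩ := map_eval_supportedIn (hD n) hv hvn ▸ Subgroup.mem_top x
  obtain ⟨hwD, hwn⟩ := mem_supportedIn.mp hw
  convert hwD
  funext m
  rcases eq_or_ne m n with rfl | hm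
  · simp
  · simp [hm, hwn m hm]

end Subdirect

/-! ### The structure of the diagonal product -/

section Structure

variable {G : Type*} [Group G] {H : ℕ → Type*} [∀ n, Group (H n)] {S : Set G}
  {θ : ∀ n, G → H n}

theorem mem_directSum {f : ∀ n, H n} : f ∈ directSum H ↔ {n | f n ≠ 1}.Finite := Iff.rfl

theorem mulSingle_mem_directSum (n : ℕ) (x : H n) : Pi.mulSingle n x ∈ directSum H :=
  mem_directSum.mpr <| (Set.finite_singleton n).subset fun _ hm => by
    contrapose! hm
    simp [Pi.mulSingle_eq_of_ne hm]

theorem tailMap_surjective (hθ : IsLEFApprox θ) (hSgen : Subgroup.closure S = ⊤) :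
    Function.Surjective (hθ.tailMap S) := by
  rw [← MonoidHom.range_eq_top, eq_top_iff, ← hSgen, Subgroup.closure_le]
  exact fun s hs => ⟨_, hθ.tailMap_generator S hs⟩

theorem tailMap_eq_iff (hθ : IsLEFApprox θ) (γ δ : diagonalProduct S θ) :
    hθ.tailMap S γ = hθ.tailMap S δ ↔
      ∀ᶠ n in atTop, (γ : ∀ n, H n) n = (δ : ∀ n, H n) n := by
  constructor
  · intro h
    filter_upwards [hθ.tailMap_spec S γ, hθ.tailMap_spec S δ] with n hγ hδ
    rw [hγ, hδ, h]
  · intro h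
    refine hθ.eq_of_eventually_eq ?_
    filter_upwards [hθ.tailMap_spec S γ, hθ.tailMap_spec S δ, h] with n hγ hδ hγδ
    rw [← hγ, ← hδ, hγδ]

theorem tailMap_ker (hθ : IsLEFApprox θ) : (hθ.tailMap S).ker = sumSubgroup S θ := by
  ext γ
  rw [MonoidHom.mem_ker, ← map_one (hθ.tailMap S), tailMap_eq_iff, ← Nat.cofinite_eq_atTop]
  exact Iff.rfl

theorem map_eval_diagonalProduct (hess : IsEssentialBySimple S θ) (n : ℕ) :
    (diagonalProduct S θ).map (Pi.evalMonoidHom H n) = ⊤ := by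
  rw [diagonalProduct, MonoidHom.map_closure, ← hess.generates n, Set.image_image]
  rfl

/-- Otherwise the `n`-th coordinate would factor through the tail map, and hence `θ n` would extend
to a homomorphism on `G`. -/
theorem exists_mem_directSum_ne_one (hθ : IsLEFApprox θ) (hSgen : Subgroup.closure S = ⊤)
    (hess : IsEssentialBySimple S θ) (n : ℕ) :
    ∃ γ ∈ diagonalProduct S θ, γ ∈ directSum H ∧ γ n ≠ 1 := by
  by_contra! hcon
  let ev : diagonalProduct S θ →* H n := (Pi.evalMonoidHom H n).comp (Subgroup.subtype _)
  have hker : (hθ.tailMap S).ker ≤ ev.ker := fun γ hγ => by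
    rw [tailMap_ker] at hγ
    exact hcon γ γ.2 hγ
  have hsurj := tailMap_surjective hθ hSgen
  refine hess.not_extend n ⟨(hθ.tailMap S).liftOfSurjective hsurj ⟨ev, hker⟩, fun s hs => ?_⟩
  conv_lhs => rw [← hθ.tailMap_generator S hs]
  exact MonoidHom.liftOfRightInverse_comp_apply _ _ _ ⟨ev, hker⟩ _

theorem directSum_le (hθ : IsLEFApprox θ) (hSgen : Subgroup.closure S = ⊤)
    (hess : IsEssentialBySimple S θ) : directSum H ≤ diagonalProduct S θ := by
  have := hess.simple
  have hsingle : ∀ n (x : H n), Pi.mulSingle n x ∈ diagonalProduct S θ := fun n => by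
    obtain ⟨γ, hγ, hγU, hγn⟩ := exists_mem_directSum_ne_one hθ hSgen hess n
    refine mulSingle_mem_of_subdirect hess.pairwise_not_iso (map_eval_diagonalProduct hess)
      ⟨(mem_directSum.mp hγU).toFinset, γ, mem_supportedIn.mpr ⟨hγ, fun i hi => ?_⟩, hγn⟩
    simpa using hi
  intro f hf
  refine Submonoid.pi_mem_of_mulSingle_mem_aux (mem_directSum.mp hf).toFinset f (fun n hn => ?_)
    fun n _ => hsingle n (f n)
  simpa using hn

end Structure

/-! ### Groups between the direct sum and the direct product -/

theorem eq_of_mapClusterPt_of_tendsto {X α : Type*} [TopologicalSpace X] [T2Space X] {l : Filter α}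
    {u : α → X} {x y : X} (hx : MapClusterPt x l u) (hy : Tendsto u l (𝓝 y)) : x = y :=
  have : (𝓝 x ⊓ 𝓝 y).NeBot := ClusterPt.mono hx hy
  eq_of_nhds_neBot this

/-- A group `W` between the direct sum and the direct product of the groups `H n`. It is given by
maps rather than as a subgroup of the product, so that the direct sum, which is here a subgroup of
the diagonal product, is covered as well. -/
structure FactorEmbedding (W : Type*) [Group W] (H : ℕ → Type*) [∀ n, Group (H n)] where
  /-- The embedding into the direct product. -/
  coord : W →* ∀ n, H n
  /-- The inclusions of the factors. -/
  incl : ∀ n, H n →* W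
  coord_injective : Function.Injective coord
  coord_incl : ∀ n x, coord (incl n x) = Pi.mulSingle n x

namespace FactorEmbedding

variable {W : Type*} [Group W] {H : ℕ → Type*} [∀ n, Group (H n)] (E : FactorEmbedding W H)

theorem ext_coord {γ δ : W} (h : ∀ m, E.coord γ m = E.coord δ m) : γ = δ :=
  E.coord_injective (funext h)

theorem commute_incl {n : ℕ} {γ : W} (hγ : E.coord γ n = 1) (x : H n) :
    Commute (E.incl n x) γ := E.ext_coord fun m => by
  rcases eq_or_ne m n with rfl | hm
  · simp [E.coord_incl, hγ]
  · simp [E.coord_incl, hm]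

theorem inv_mul_incl_mul (γ : W) (n : ℕ) (x : H n) :
    γ⁻¹ * E.incl n x * γ = E.incl n ((E.coord γ n)⁻¹ * x * E.coord γ n) :=
  E.ext_coord fun m => by
    rcases eq_or_ne m n with rfl | hm
    · simp [E.coord_incl]
    · simp [E.coord_incl, hm]

theorem coord_incl_inv_mul (n : ℕ) (γ : W) :
    E.coord ((E.incl n (E.coord γ n))⁻¹ * γ) = Function.update (E.coord γ) n 1 := by
  funext m
  rcases eq_or_ne m n with rfl | hm
  · simp [E.coord_incl]
  · simp [E.coord_incl, hm]

/-- Replace the `n`-th coordinate of an element by `1`. -/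
def eraseAt (n : ℕ) : W →* W where
  toFun γ := (E.incl n (E.coord γ n))⁻¹ * γ
  map_one' := by simp
  map_mul' γ δ := E.ext_coord fun m => by
    rw [coord_incl_inv_mul, map_mul E.coord (_ * γ), coord_incl_inv_mul, coord_incl_inv_mul]
    rcases eq_or_ne m n with rfl | hm
    · simp
    · simp [hm]

theorem incl_mul_eraseAt (n : ℕ) (γ : W) : E.incl n (E.coord γ n) * E.eraseAt n γ = γ :=
  mul_inv_cancel_left _ γ

theorem coord_eraseAt (n : ℕ) (γ : W) :
    E.coord (E.eraseAt n γ) = Function.update (E.coord γ) n 1 :=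
  E.coord_incl_inv_mul n γ

/-- Replace the first `n` coordinates of an element by `1`. -/
def erase : ℕ → W →* W
  | 0 => MonoidHom.id W
  | n + 1 => (E.eraseAt n).comp (erase n)

theorem coord_erase (n : ℕ) (γ : W) (m : ℕ) :
    E.coord (E.erase n γ) m = if m < n then 1 else E.coord γ m := by
  induction n with
  | zero => simp [erase]
  | succ n ih =>
    rw [erase, MonoidHom.comp_apply, coord_eraseAt]
    rcases lt_trichotomy m n with h | rfl | h
    · simp [ih, h, h.ne, h.trans (Nat.lt_succ_self n)]
    · simp
    · simp [ih, h.ne', h.not_gt, (Nat.succ_le_of_lt h).not_gt]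

theorem erase_eq_iff (n : ℕ) (γ δ : W) :
    E.erase n γ = E.erase n δ ↔ ∀ m, n ≤ m → E.coord γ m = E.coord δ m := by
  rw [← E.coord_injective.eq_iff, funext_iff]
  simp only [coord_erase]
  refine forall_congr' fun m => ?_
  by_cases h : m < n
  · simp [h]
  · simp [h, not_lt.mp h]

theorem eventually_erase_eq {γ δ : W} (h : ∀ᶠ m in atTop, E.coord γ m = E.coord δ m) :
    ∀ᶠ n in atTop, E.erase n γ = E.erase n δ := by
  obtain ⟨N, hN⟩ := eventually_atTop.mp h
  filter_upwards [eventually_ge_atTop N] with n hn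
  exact (E.erase_eq_iff n γ δ).mpr fun m hm => hN m (hn.trans hm)

/-- The function `γ ↦ ∏ i < n, φ i (γ i)`. -/
def partialProd (φ : ∀ n, H n → ℂ) (n : ℕ) : W → ℂ :=
  fun γ => ∏ i ∈ Finset.range n, φ i (E.coord γ i)

/-- The traces on `W` whose restriction to the `n`-th factor is `φ n`, for every `n`. -/
def tracesOver (φ : ∀ n, H n → ℂ) : Set (W → ℂ) :=
  {ζ | ζ ∈ Tr W ∧ ∀ n x, ζ (E.incl n x) = φ n x}

variable {E} {φ : ∀ n, H n → ℂ} {ζ φhat : W → ℂ}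

theorem isTrace_partialProd (hφ : ∀ n, IsTrace (φ n)) (n : ℕ) : IsTrace (E.partialProd φ n) := by
  have : E.partialProd φ n =
      ∏ i ∈ Finset.range n, φ i ∘ (Pi.evalMonoidHom H i).comp E.coord := by
    ext γ
    simp [partialProd]
  rw [this]
  exact IsTrace.prod _ fun i _ => (hφ i).comp _

theorem partialProd_incl (hφ : ∀ n, φ n 1 = 1) {N n : ℕ} (h : n < N) (x : H n) :
    E.partialProd φ N (E.incl n x) = φ n x := by
  rw [partialProd, Finset.prod_eq_single n]
  · rw [E.coord_incl, Pi.mulSingle_eq_same]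
  · intro m _ hm
    rw [E.coord_incl, Pi.mulSingle_eq_of_ne hm, hφ]
  · simp [h]

theorem isExtreme_tracesOver (hφ : ∀ n, φ n ∈ Ch (H n)) :
    IsExtreme ℝ (Tr W) (E.tracesOver φ) := by
  refine ⟨fun ζ hζ => hζ.1, fun a ha b hb ζ hζ hseg => ⟨ha, fun n x => ?_⟩⟩
  obtain ⟨s, t, hs, ht, hst, rfl⟩ := hseg
  have hrestr : s • (a ∘ E.incl n) + t • (b ∘ E.incl n) = φ n := funext (hζ.2 n)
  exact congrFun ((hφ n).2 (ha.comp (E.incl n)) (hb.comp (E.incl n))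
    ⟨s, t, hs, ht, hst, hrestr⟩) x

theorem comp_incl_mem_Ch [∀ n, Finite (H n)] (hζ : ζ ∈ Ch W) (n : ℕ) : ζ ∘ E.incl n ∈ Ch (H n) :=
  comp_mem_Ch_of_inner hζ fun g => ⟨_, E.inv_mul_incl_mul g n⟩

theorem eq_mul_eraseAt (hφ : ∀ n, φ n ∈ Ch (H n)) (hζ : ζ ∈ E.tracesOver φ) (n : ℕ) (γ : W) :
    ζ γ = φ n (E.coord γ n) * ζ (E.eraseAt n γ) := by
  have hrestr : ζ ∘ E.incl n = φ n := funext (hζ.2 n)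
  rw [← hζ.2, ← hζ.1.map_mul_of_commute (hrestr ▸ hφ n) _
    (E.commute_incl (by simp [coord_eraseAt])), incl_mul_eraseAt]

theorem eq_partialProd_mul (hφ : ∀ n, φ n ∈ Ch (H n)) (hζ : ζ ∈ E.tracesOver φ) (n : ℕ) (γ : W) :
    ζ γ = E.partialProd φ n γ * ζ (E.erase n γ) := by
  induction n with
  | zero => simp [partialProd, erase]
  | succ n ih =>
    rw [ih, eq_mul_eraseAt hφ hζ n (E.erase n γ), coord_erase, if_neg (lt_irrefl n), partialProd,
      partialProd, Finset.prod_range_succ, mul_assoc]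
    rfl

theorem exists_mapClusterPt_partialProd (hφ : ∀ n, IsTrace (φ n)) :
    ∃ φhat, MapClusterPt φhat atTop (E.partialProd φ) := by
  obtain ⟨φhat, -, hhat⟩ := isCompact_Tr.exists_mapClusterPt (f := atTop) (u := E.partialProd φ)
    (tendsto_principal.mpr (.of_forall (isTrace_partialProd hφ)))
  exact ⟨φhat, hhat⟩

theorem mem_tracesOver_of_mapClusterPt (hφ : ∀ n, IsTrace (φ n))
    (hhat : MapClusterPt φhat atTop (E.partialProd φ)) : φhat ∈ E.tracesOver φ := by
  refine ⟨isClosed_Tr.mem_of_mapClusterPt hhat (.of_forall (isTrace_partialProd hφ)),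
    fun n x => ?_⟩
  have hclosed : IsClosed {f : W → ℂ | f (E.incl n x) = φ n x} :=
    isClosed_eq (continuous_apply _) continuous_const
  refine hclosed.mem_of_mapClusterPt hhat ?_
  filter_upwards [eventually_gt_atTop n] with N hN
  exact partialProd_incl (fun n => (hφ n).normalized) hN x

theorem tendsto_norm_partialProd (hφ : ∀ n, IsTrace (φ n))
    (hhat : MapClusterPt φhat atTop (E.partialProd φ)) (γ : W) :
    Tendsto (fun n => ‖E.partialProd φ n γ‖) atTop (𝓝 ‖φhat γ‖) := by
  have hanti : Antitone fun n => ‖E.partialProd φ n γ‖ := by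
    refine antitone_nat_of_succ_le fun n => ?_
    rw [partialProd, partialProd, Finset.prod_range_succ, norm_mul]
    exact mul_le_of_le_one_right (norm_nonneg _) ((hφ n).norm_le_one _)
  have hlim := tendsto_atTop_ciInf hanti
    ⟨0, Set.forall_mem_range.mpr fun _ => norm_nonneg _⟩
  have hcluster : MapClusterPt ‖φhat γ‖ atTop fun n => ‖E.partialProd φ n γ‖ :=
    hhat.continuousAt_comp (f := fun f : W → ℂ => ‖f γ‖) (continuous_apply γ).norm.continuousAt
  rwa [eq_of_mapClusterPt_of_tendsto hcluster hlim]

theorem norm_le_of_mapClusterPt (hφ : ∀ n, φ n ∈ Ch (H n)) (hζ : ζ ∈ E.tracesOver φ)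
    (hhat : MapClusterPt φhat atTop (E.partialProd φ)) (γ : W) : ‖ζ γ‖ ≤ ‖φhat γ‖ := by
  refine ge_of_tendsto' (tendsto_norm_partialProd (fun n => isTrace_of_mem_Ch (hφ n)) hhat γ)
    fun n => ?_
  rw [eq_partialProd_mul hφ hζ n, norm_mul]
  exact mul_le_of_le_one_right (norm_nonneg _) (hζ.1.norm_le_one _)

theorem tendsto_norm_erase (hφ : ∀ n, φ n ∈ Ch (H n))
    (hhat : MapClusterPt φhat atTop (E.partialProd φ)) {γ : W} (hγ : φhat γ ≠ 0) :
    Tendsto (fun n => ‖φhat (E.erase n γ)‖) atTop (𝓝 1) := by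
  have hφT := fun n => isTrace_of_mem_Ch (hφ n)
  have hnorm : ‖φhat γ‖ ≠ 0 := norm_ne_zero_iff.mpr hγ
  have hfactor := fun n => eq_partialProd_mul hφ (mem_tracesOver_of_mapClusterPt hφT hhat) n γ
  have hlim : Tendsto (fun n => ‖φhat γ‖ / ‖E.partialProd φ n γ‖) atTop (𝓝 1) :=
    div_self hnorm ▸ tendsto_const_nhds.div (tendsto_norm_partialProd hφT hhat γ) hnorm
  refine hlim.congr fun n => ?_
  have hP : ‖E.partialProd φ n γ‖ ≠ 0 := fun h0 =>
    hγ (by rw [hfactor n, norm_eq_zero.mp h0, zero_mul])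
  rw [div_eq_iff hP, mul_comm, ← norm_mul, ← hfactor]

/-- This makes `ζ / φhat`, off the zeros of `φhat`, a limit of traces: in `ζ * star φhat` the phase
of `partialProd φ n`, which need not converge, cancels. -/
theorem tendsto_mul_conj_erase (hφ : ∀ n, φ n ∈ Ch (H n)) (hζ : ζ ∈ E.tracesOver φ)
    (hhat : MapClusterPt φhat atTop (E.partialProd φ)) {γ : W} (hγ : φhat γ ≠ 0) :
    Tendsto (fun n => (ζ * star φhat) (E.erase n γ)) atTop (𝓝 (ζ γ / φhat γ)) := by
  have hmem := mem_tracesOver_of_mapClusterPt (fun n => isTrace_of_mem_Ch (hφ n)) hhat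
  have hlim : Tendsto (fun n => ζ γ / φhat γ * (‖φhat (E.erase n γ)‖ : ℂ) ^ 2) atTop
      (𝓝 (ζ γ / φhat γ)) := by
    have h := ((Complex.continuous_ofReal.tendsto 1).comp (tendsto_norm_erase hφ hhat hγ)).pow 2
    simpa using h.const_mul (ζ γ / φhat γ)
  refine hlim.congr fun n => ?_
  have hfactor := eq_partialProd_mul hφ hmem n γ
  have hP : E.partialProd φ n γ ≠ 0 := fun h0 => hγ (by rw [hfactor, h0, zero_mul])
  have htail : φhat (E.erase n γ) ≠ 0 := fun h0 => hγ (by rw [hfactor, h0, mul_zero])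
  rw [eq_partialProd_mul hφ hζ n γ, hfactor, ← Complex.mul_conj', mul_div_mul_left _ _ hP,
    ← mul_assoc, div_mul_cancel₀ _ htail]
  rfl

end FactorEmbedding

/-! ### Characters of the direct sum -/

section Sum

variable {G : Type*} {H : ℕ → Type*} [∀ n, Group (H n)] {S : Set G}
  {θ : ∀ n, G → H n} {φ : ∀ n, H n → ℂ}

/-- The diagonal product lies between the direct sum and the direct product. -/
def diagonalEmbedding (hU : directSum H ≤ diagonalProduct S θ) :
    FactorEmbedding (diagonalProduct S θ) H where
  coord := (diagonalProduct S θ).subtype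
  incl n := (MonoidHom.mulSingle H n).codRestrict _ fun x => hU (mulSingle_mem_directSum n x)
  coord_injective := Subtype.coe_injective
  coord_incl _ _ := rfl

/-- The extreme case in which `W` is the direct sum itself, as a subgroup of the diagonal
product. -/
def sumEmbedding (hU : directSum H ≤ diagonalProduct S θ) :
    FactorEmbedding (sumSubgroup S θ) H where
  coord := (diagonalProduct S θ).subtype.comp (sumSubgroup S θ).subtype
  incl n := ((diagonalEmbedding hU).incl n).codRestrict _ fun x => mulSingle_mem_directSum n x
  coord_injective := Subtype.coe_injective.comp Subtype.coe_injective
  coord_incl _ _ := rfl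

variable (hU : directSum H ≤ diagonalProduct S θ)

theorem eventually_coord_sumEmbedding_eq_one (u : sumSubgroup S θ) :
    ∀ᶠ n in atTop, (sumEmbedding hU).coord u n = 1 := by
  rw [← Nat.cofinite_eq_atTop]
  exact u.2

theorem tendsto_partialProd_tensor (hφ : ∀ n, φ n 1 = 1) :
    Tendsto ((sumEmbedding hU).partialProd φ) atTop (𝓝 (tensor S θ φ)) := by
  refine tendsto_pi_nhds.mpr fun u => tendsto_const_nhds.congr' ?_
  obtain ⟨N, hN⟩ := eventually_atTop.mp (eventually_coord_sumEmbedding_eq_one hU u)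
  filter_upwards [eventually_ge_atTop N] with n hn
  refine finprod_eq_prod_of_mulSupport_subset _ fun i hi => ?_
  by_contra hin
  have hi1 : (sumEmbedding hU).coord u i = 1 := hN i (hn.trans (by simpa using hin))
  exact hi ((congrArg (φ i) hi1).trans (hφ i))

theorem tracesOver_sumEmbedding (hφ : ∀ n, φ n ∈ Ch (H n)) :
    (sumEmbedding hU).tracesOver φ = {tensor S θ φ} := by
  have hφT := fun n => isTrace_of_mem_Ch (hφ n)
  have hlim := tendsto_partialProd_tensor hU fun n => (hφT n).normalized
  refine Set.Subset.antisymm (fun ζ hζ => funext fun u => ?_) (Set.singleton_subset_iff.mpr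
    (FactorEmbedding.mem_tracesOver_of_mapClusterPt hφT hlim.mapClusterPt))
  refine tendsto_nhds_unique ?_ (tendsto_pi_nhds.mp hlim u)
  refine tendsto_const_nhds.congr' ?_
  have htail : ∀ᶠ n in atTop, (sumEmbedding hU).erase n u = (sumEmbedding hU).erase n 1 :=
    (sumEmbedding hU).eventually_erase_eq <| by
      simpa using eventually_coord_sumEmbedding_eq_one hU u
  filter_upwards [htail] with n hn
  rw [FactorEmbedding.eq_partialProd_mul hφ hζ n, hn, map_one, hζ.1.normalized, mul_one]

theorem tensor_mem_Ch (hU : directSum H ≤ diagonalProduct S θ) (hφ : ∀ n, φ n ∈ Ch (H n)) :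
    tensor S θ φ ∈ Ch (sumSubgroup S θ) := by
  rw [Ch, ← isExtreme_singleton, ← tracesOver_sumEmbedding hU hφ]
  exact FactorEmbedding.isExtreme_tracesOver hφ

theorem tensor_incl (hφ : ∀ n, φ n ∈ Ch (H n)) (n : ℕ) (x : H n) :
    tensor S θ φ ((sumEmbedding hU).incl n x) = φ n x :=
  ((tracesOver_sumEmbedding hU hφ).superset rfl).2 n x

theorem tensor_bijOn [∀ n, Finite (H n)] (hU : directSum H ≤ diagonalProduct S θ) :
    Set.BijOn (tensor S θ) {φ | ∀ n, φ n ∈ Ch (H n)} (Ch (sumSubgroup S θ)) := by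
  refine ⟨fun φ hφ => tensor_mem_Ch hU hφ, fun φ hφ φ' hφ' h => ?_, fun ζ hζ => ?_⟩
  · funext n x
    rw [← tensor_incl hU hφ n x, h, tensor_incl hU hφ' n x]
  · have hφ : ∀ n, ζ ∘ (sumEmbedding hU).incl n ∈ Ch (H n) :=
      FactorEmbedding.comp_incl_mem_Ch hζ
    have hζφ : ζ ∈ (sumEmbedding hU).tracesOver fun n => ζ ∘ (sumEmbedding hU).incl n :=
      ⟨isTrace_of_mem_Ch hζ, fun _ _ => rfl⟩
    rw [tracesOver_sumEmbedding hU hφ] at hζφ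
    exact ⟨_, hφ, hζφ.symm⟩

theorem tracesOver_diagonalEmbedding (hφ : ∀ n, φ n ∈ Ch (H n)) :
    (diagonalEmbedding hU).tracesOver φ = tracesOver S θ φ := by
  ext ζ
  refine and_congr_right fun hζ => ⟨fun h => ?_, fun h n x => ?_⟩
  · have hmem : ζ ∘ (sumSubgroup S θ).subtype ∈ (sumEmbedding hU).tracesOver φ :=
      ⟨hζ.comp _, h⟩
    rwa [tracesOver_sumEmbedding hU hφ] at hmem
  · rw [← tensor_incl hU hφ n x, ← h]
    rfl

end Sum

/-! ### Linear maps that are injective on a convex set -/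

theorem image_extremePoints_of_injOn {𝕜 X Y : Type*} [Semiring 𝕜] [PartialOrder 𝕜]
    [AddCommMonoid X] [Module 𝕜 X] [AddCommMonoid Y] [Module 𝕜 Y] {f : X →ₗ[𝕜] Y} {A : Set X}
    (hA : Convex 𝕜 A) (hinj : Set.InjOn f A) :
    f '' A.extremePoints 𝕜 = (f '' A).extremePoints 𝕜 := by
  ext y
  constructor
  · rintro ⟨x, hx, rfl⟩
    refine ⟨⟨x, hx.1, rfl⟩, ?_⟩
    rintro _ ⟨a, ha, rfl⟩ _ ⟨b, hb, rfl⟩ ⟨s, t, hs, ht, hst, h⟩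
    rw [← map_smul, ← map_smul, ← map_add] at h
    have hx_eq := hinj (hA ha hb hs.le ht.le hst) hx.1 h
    rw [hx.2 ha hb ⟨s, t, hs, ht, hst, hx_eq⟩]
  · rintro ⟨⟨x, hx, rfl⟩, h⟩
    refine ⟨x, ⟨hx, ?_⟩, rfl⟩
    rintro a ha b hb ⟨s, t, hs, ht, hst, rfl⟩
    exact hinj ha hx (h ⟨a, ha, rfl⟩ ⟨b, hb, rfl⟩ ⟨s, t, hs, ht, hst, by simp⟩)

section Homeomorphism

variable {X Y : Type*} [AddCommGroup X] [Module ℂ X] [TopologicalSpace X]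
  [AddCommGroup Y] [Module ℂ Y] [TopologicalSpace Y] {f : X →ₗ[ℂ] Y} {A B : Set X}

theorem restrictsToHomeomorph_image (hf : IsEmbedding fun x : A => f x) :
    RestrictsToHomeomorph f A (f '' A) :=
  ⟨hf.toHomeomorph.trans (Homeomorph.setCongr (by rw [Set.image_eq_range])), fun _ => rfl⟩

theorem restrictsToHomeomorph_image_of_isCompact [T2Space Y] (hf : Continuous f)
    (hinj : Set.InjOn f A) (hA : IsCompact A) (hBA : B ⊆ A) :
    RestrictsToHomeomorph f B (f '' B) := by
  have := isCompact_iff_compactSpace.mp hA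
  have hembedding := ((hf.comp continuous_subtype_val).isClosedEmbedding
    (Set.injOn_iff_injective.mp hinj)).isEmbedding
  exact restrictsToHomeomorph_image (hembedding.comp (IsEmbedding.inclusion hBA))

end Homeomorphism

/-! ### Traces over a character of the direct sum -/

section Twist

variable {G : Type*} [Group G] {H : ℕ → Type*} [∀ n, Group (H n)] {S : Set G}
  {θ : ∀ n, G → H n} (hθ : IsLEFApprox θ) {φ : ∀ n, H n → ℂ}
  (hU : directSum H ≤ diagonalProduct S θ) {ζ φhat : diagonalProduct S θ → ℂ}

theorem tailMap_erase (n : ℕ) (γ : diagonalProduct S θ) :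
    hθ.tailMap S ((diagonalEmbedding hU).erase n γ) = hθ.tailMap S γ := by
  rw [tailMap_eq_iff]
  filter_upwards [eventually_ge_atTop n] with m hm
  have := (diagonalEmbedding hU).coord_erase n γ m
  rwa [if_neg hm.not_gt] at this

theorem isNull_iff (hU : directSum H ≤ diagonalProduct S θ) (hφ : ∀ n, IsTrace (φ n))
    (hhat : IsAuxiliary S θ φ φhat) (τ : G) :
    IsNull S hθ φ τ ↔ ∀ γ, hθ.tailMap S γ = τ → φhat γ = 0 := by
  refine forall_congr' fun γ => imp_congr_right fun _ => ?_
  have h := FactorEmbedding.tendsto_norm_partialProd (E := diagonalEmbedding hU) hφ hhat γ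
  simp only [FactorEmbedding.partialProd, norm_prod] at h
  refine ⟨fun h0 => norm_eq_zero.mp (tendsto_nhds_unique h h0), fun h0 => ?_⟩
  rwa [h0, norm_zero] at h

theorem convex_compatibleTraces : Convex ℝ (compatibleTraces S hθ φ) := by
  intro a ha b hb s t hs ht hst
  refine ⟨convex_Tr ha.1 hb.1 hs ht hst, fun τ hτ => ?_⟩
  simp [ha.2 τ hτ, hb.2 τ hτ]

theorem isCompact_compatibleTraces : IsCompact (compatibleTraces S hθ φ) := by
  refine isCompact_Tr.of_isClosed_subset ?_ fun ψ hψ => hψ.1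
  refine isClosed_Tr.inter (s₂ := {ψ | ∀ τ, IsNull S hθ φ τ → ψ τ = 0}) ?_
  simp only [Set.ofPred_forall]
  exact isClosed_iInter fun τ => isClosed_iInter fun _ =>
    isClosed_eq (continuous_apply τ) continuous_const

theorem continuous_twist : Continuous (twist S hθ φhat) :=
  continuous_pi fun γ => continuous_const.mul (continuous_apply (hθ.tailMap S γ))

theorem twist_injOn (hU : directSum H ≤ diagonalProduct S θ) (hφ : ∀ n, IsTrace (φ n))
    (hhat : IsAuxiliary S θ φ φhat) :
    Set.InjOn (twist S hθ φhat) (compatibleTraces S hθ φ) := by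
  intro ψ₁ h₁ ψ₂ h₂ h
  funext τ
  by_cases hτ : IsNull S hθ φ τ
  · rw [h₁.2 τ hτ, h₂.2 τ hτ]
  · rw [isNull_iff hθ hU hφ hhat] at hτ
    push Not at hτ
    obtain ⟨γ, rfl, hγ⟩ := hτ
    exact mul_left_cancel₀ hγ (congrFun h γ)

theorem twist_mem_tracesOver (hU : directSum H ≤ diagonalProduct S θ) (hφ : ∀ n, φ n ∈ Ch (H n))
    (hhat : IsAuxiliary S θ φ φhat) {ψ : G → ℂ} (hψ : ψ ∈ Tr G) :
    twist S hθ φhat ψ ∈ tracesOver S θ φ := by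
  have hhatφ := FactorEmbedding.mem_tracesOver_of_mapClusterPt (E := diagonalEmbedding hU)
    (fun n => isTrace_of_mem_Ch (hφ n)) hhat
  rw [← tracesOver_diagonalEmbedding hU hφ]
  refine ⟨hhatφ.1.mul (hψ.comp (hθ.tailMap S)), fun n x => ?_⟩
  have htail : hθ.tailMap S ((diagonalEmbedding hU).incl n x) = 1 := by
    rw [← MonoidHom.mem_ker, tailMap_ker]
    exact mulSingle_mem_directSum n x
  change φhat _ * ψ _ = _
  rw [htail, hψ.normalized, mul_one, hhatφ.2]

/-- The maps `erase n` eventually identify any two elements with the same tail. -/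
theorem exists_mapClusterPt_comp_tailMap (hsurj : Function.Surjective (hθ.tailMap S))
    {P : diagonalProduct S θ → ℂ} (hP : IsTrace P) :
    ∃ ψ ∈ Tr G, MapClusterPt (ψ ∘ hθ.tailMap S) atTop
      fun n => P ∘ (diagonalEmbedding hU).erase n := by
  obtain ⟨f, hf, hcluster⟩ := isCompact_Tr.exists_mapClusterPt (f := atTop)
    (u := fun n => P ∘ (diagonalEmbedding hU).erase n)
    (tendsto_principal.mpr (.of_forall fun n => hP.comp _))
  have hfactors : f.FactorsThrough (hθ.tailMap S) := fun γ δ h => by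
    have hclosed : IsClosed {f : diagonalProduct S θ → ℂ | f γ = f δ} :=
      isClosed_eq (continuous_apply γ) (continuous_apply δ)
    refine hclosed.mem_of_mapClusterPt hcluster ?_
    have htails := (diagonalEmbedding hU).eventually_erase_eq ((tailMap_eq_iff hθ γ δ).mp h)
    filter_upwards [htails] with n hn
    exact congrArg P hn
  obtain ⟨ψ, rfl⟩ := (Function.factorsThrough_iff f).mp hfactors
  exact ⟨ψ, .of_comp_surjective hsurj hf, hcluster⟩

theorem exists_twist_eq (hU : directSum H ≤ diagonalProduct S θ)
    (hsurj : Function.Surjective (hθ.tailMap S)) (hφ : ∀ n, φ n ∈ Ch (H n))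
    (hhat : IsAuxiliary S θ φ φhat) (hζ : ζ ∈ tracesOver S θ φ) :
    ∃ ψ ∈ compatibleTraces S hθ φ, twist S hθ φhat ψ = ζ := by
  have hφT := fun n => isTrace_of_mem_Ch (hφ n)
  have hhatT := (FactorEmbedding.mem_tracesOver_of_mapClusterPt (E := diagonalEmbedding hU)
    hφT hhat).1
  rw [← tracesOver_diagonalEmbedding hU hφ] at hζ
  obtain ⟨ψ, hψ, hcluster⟩ := exists_mapClusterPt_comp_tailMap hθ hU hsurj (hζ.1.mul hhatT.conj)
  have happly : ∀ γ, MapClusterPt (ψ (hθ.tailMap S γ)) atTop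
      fun n => (ζ * star φhat) ((diagonalEmbedding hU).erase n γ) := fun γ =>
    hcluster.continuousAt_comp (f := fun f => f γ) (continuous_apply γ).continuousAt
  refine ⟨ψ, ⟨hψ, fun τ hτ => ?_⟩, funext fun γ => ?_⟩
  · obtain ⟨γ, rfl⟩ := hsurj τ
    have hzero : ∀ n, φhat ((diagonalEmbedding hU).erase n γ) = 0 := fun n =>
      (isNull_iff hθ hU hφT hhat _).mp hτ _ (tailMap_erase hθ hU n γ)
    refine eq_of_mapClusterPt_of_tendsto (happly γ) ?_
    simp [hzero]
  · change φhat γ * ψ (hθ.tailMap S γ) = ζ γ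
    by_cases hγ : φhat γ = 0
    · have hle := FactorEmbedding.norm_le_of_mapClusterPt hφ hζ hhat γ
      rw [hγ, norm_zero, norm_le_zero_iff] at hle
      rw [hγ, zero_mul, hle]
    · rw [eq_of_mapClusterPt_of_tendsto (happly γ)
        (FactorEmbedding.tendsto_mul_conj_erase hφ hζ hhat hγ), mul_div_cancel₀ _ hγ]

theorem twist_image (hU : directSum H ≤ diagonalProduct S θ)
    (hsurj : Function.Surjective (hθ.tailMap S)) (hφ : ∀ n, φ n ∈ Ch (H n))
    (hhat : IsAuxiliary S θ φ φhat) :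
    twist S hθ φhat '' compatibleTraces S hθ φ = tracesOver S θ φ :=
  Set.Subset.antisymm
    (Set.image_subset_iff.mpr fun _ hψ => twist_mem_tracesOver hθ hU hφ hhat hψ.1)
    fun _ hζ => exists_twist_eq hθ hU hsurj hφ hhat hζ

theorem twist_image_compatibleCharacters (hU : directSum H ≤ diagonalProduct S θ)
    (hsurj : Function.Surjective (hθ.tailMap S)) (hφ : ∀ n, φ n ∈ Ch (H n))
    (hhat : IsAuxiliary S θ φ φhat) :
    twist S hθ φhat '' compatibleCharacters S hθ φ =
      tracesOver S θ φ ∩ Ch (diagonalProduct S θ) := by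
  have hface : IsExtreme ℝ (Tr (diagonalProduct S θ)) (tracesOver S θ φ) := by
    rw [← tracesOver_diagonalEmbedding hU hφ]
    exact FactorEmbedding.isExtreme_tracesOver hφ
  have hinj := twist_injOn hθ hU (fun n => isTrace_of_mem_Ch (hφ n)) hhat
  rw [Ch, ← hface.extremePoints_eq, ← twist_image hθ hU hsurj hφ hhat]
  exact image_extremePoints_of_injOn (f := (twist S hθ φhat).restrictScalars ℝ)
    (convex_compatibleTraces hθ) hinj

theorem twist_bijOn [∀ n, Finite (H n)] (hU : directSum H ≤ diagonalProduct S θ)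
    (hsurj : Function.Surjective (hθ.tailMap S))
    {aux : (∀ n, H n → ℂ) → (diagonalProduct S θ → ℂ)}
    (haux : ∀ φ, (∀ n, φ n ∈ Ch (H n)) → IsAuxiliary S θ φ (aux φ)) :
    Set.BijOn (fun p : (∀ n, H n → ℂ) × (G → ℂ) => twist S hθ (aux p.1) p.2)
      {p | (∀ n, p.1 n ∈ Ch (H n)) ∧ p.2 ∈ compatibleCharacters S hθ p.1}
      (Ch (diagonalProduct S θ)) := by
  have himage := fun φ (hφ : ∀ n, φ n ∈ Ch (H n)) =>
    twist_image_compatibleCharacters (φ := φ) hθ hU hsurj hφ (haux φ hφ)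
  refine ⟨?_, ?_, fun ζ hζ => ?_⟩
  · rintro ⟨φ, ψ⟩ ⟨hφ, hψ⟩
    exact ((himage φ hφ).subset ⟨ψ, hψ, rfl⟩).2
  · rintro ⟨φ, ψ⟩ ⟨hφ, hψ⟩ ⟨φ', ψ'⟩ ⟨hφ', hψ'⟩ h
    dsimp only at h hφ hφ' hψ hψ'
    have hrestr := ((himage φ hφ).subset ⟨ψ, hψ, rfl⟩).1.2
    have hrestr' := ((himage φ' hφ').subset ⟨ψ', hψ', rfl⟩).1.2
    rw [h] at hrestr
    obtain rfl := (tensor_bijOn hU).injOn hφ hφ' (hrestr.symm.trans hrestr')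
    rw [twist_injOn hθ hU (fun n => isTrace_of_mem_Ch (hφ n)) (haux φ hφ) hψ.1 hψ'.1 h]
  · have hφ : ∀ n, ζ ∘ (diagonalEmbedding hU).incl n ∈ Ch (H n) :=
      FactorEmbedding.comp_incl_mem_Ch hζ
    have hζφ : ζ ∈ tracesOver S θ fun n => ζ ∘ (diagonalEmbedding hU).incl n := by
      rw [← tracesOver_diagonalEmbedding hU hφ]
      exact ⟨isTrace_of_mem_Ch hζ, fun _ _ => rfl⟩
    obtain ⟨ψ, hψ, h⟩ := (himage _ hφ).superset ⟨hζφ, hζ⟩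
    exact ⟨(_, ψ), ⟨hφ, hψ⟩, h⟩

end Twist

end DiagProd

end

theorem theorem1p4_general {G : Type*} [Group G] (S : Set G) (hSgen : Subgroup.closure S = ⊤)
    {H : ℕ → Type*} [∀ n, Group (H n)] (θ : ∀ n, G → H n)
    (hθ : DiagProd.IsLEFApprox θ) (hess : DiagProd.IsEssentialBySimple S θ) :
    (Function.Surjective (hθ.tailMap S) ∧
      (hθ.tailMap S).ker = DiagProd.sumSubgroup S θ ∧
      DiagProd.directSum H ≤ DiagProd.diagonalProduct S θ) ∧
    Set.BijOn (DiagProd.tensor S θ) {φ | ∀ n, φ n ∈ DiagProd.Ch (H n)}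
      (DiagProd.Ch (DiagProd.sumSubgroup S θ)) ∧
    (∀ φ : ∀ n, H n → ℂ, (∀ n, φ n ∈ DiagProd.Ch (H n)) →
      (∃ φhat, DiagProd.IsAuxiliary S θ φ φhat) ∧
      ∀ φhat, DiagProd.IsAuxiliary S θ φ φhat →
        φhat ∈ DiagProd.Tr (DiagProd.diagonalProduct S θ) ∧
        DiagProd.RestrictsToHomeomorph (DiagProd.twist S hθ φhat)
          (DiagProd.compatibleTraces S hθ φ) (DiagProd.tracesOver S θ φ) ∧
        DiagProd.RestrictsToHomeomorph (DiagProd.twist S hθ φhat)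
          (DiagProd.compatibleCharacters S hθ φ)
          (DiagProd.tracesOver S θ φ ∩ DiagProd.Ch (DiagProd.diagonalProduct S θ))) ∧
    (∀ aux : (∀ n, H n → ℂ) → (DiagProd.diagonalProduct S θ → ℂ),
      (∀ φ, (∀ n, φ n ∈ DiagProd.Ch (H n)) → DiagProd.IsAuxiliary S θ φ (aux φ)) →
      Set.BijOn
        (fun p : (∀ n, H n → ℂ) × (G → ℂ) => DiagProd.twist S hθ (aux p.1) p.2)
        {p | (∀ n, p.1 n ∈ DiagProd.Ch (H n)) ∧ p.2 ∈ DiagProd.compatibleCharacters S hθ p.1}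
        (DiagProd.Ch (DiagProd.diagonalProduct S θ))) := by
  have hfin := hθ.finite
  have hsurj := DiagProd.tailMap_surjective hθ hSgen
  have hU := DiagProd.directSum_le hθ hSgen hess
  refine ⟨⟨hsurj, DiagProd.tailMap_ker hθ, hU⟩, DiagProd.tensor_bijOn hU, fun φ hφ => ?_,
    fun aux haux => DiagProd.twist_bijOn hθ hU hsurj haux⟩
  have hφT := fun n => DiagProd.isTrace_of_mem_Ch (hφ n)
  let E := DiagProd.diagonalEmbedding hU
  refine ⟨E.exists_mapClusterPt_partialProd hφT, fun φhat hhat => ?_⟩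
  have hcompact := DiagProd.isCompact_compatibleTraces (S := S) (φ := φ) hθ
  have hcontinuous := DiagProd.continuous_twist (S := S) (φhat := φhat) hθ
  have hinj := DiagProd.twist_injOn hθ hU hφT hhat
  refine ⟨(E.mem_tracesOver_of_mapClusterPt hφT hhat).1, ?_, ?_⟩
  · rw [← DiagProd.twist_image hθ hU hsurj hφ hhat]
    exact DiagProd.restrictsToHomeomorph_image_of_isCompact hcontinuous hinj hcompact subset_rfl
  · rw [← DiagProd.twist_image_compatibleCharacters hθ hU hsurj hφ hhat]
    exact DiagProd.restrictsToHomeomorph_image_of_isCompact hcontinuous hinj hcompact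
      extremePoints_subset

theorem theorem1p4 {G : Type*} [Group G] (S : Set G) (hSfin : S.Finite)
    (hSgen : Subgroup.closure S = ⊤)
    {H : ℕ → Type*} [∀ n, Group (H n)] (θ : ∀ n, G → H n)
    (hθ : DiagProd.IsLEFApprox θ) (hess : DiagProd.IsEssentialBySimple S θ) :
    -- `t` is onto, its kernel is `U`, and `U` is all of `⊕ H n`
    (Function.Surjective (hθ.tailMap S) ∧
      (hθ.tailMap S).ker = DiagProd.sumSubgroup S θ ∧
      DiagProd.directSum H ≤ DiagProd.diagonalProduct S θ) ∧
    -- every character of `U` is `⊗ φ n` for a unique sequence of characters `φ n` of `H n`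
    Set.BijOn (DiagProd.tensor S θ) {φ | ∀ n, φ n ∈ DiagProd.Ch (H n)}
      (DiagProd.Ch (DiagProd.sumSubgroup S θ)) ∧
    -- traces over a fixed character `φ = ⊗ φ n` of `U`
    (∀ φ : ∀ n, H n → ℂ, (∀ n, φ n ∈ DiagProd.Ch (H n)) →
      (∃ φhat, DiagProd.IsAuxiliary S θ φ φhat) ∧
      ∀ φhat, DiagProd.IsAuxiliary S θ φ φhat →
        φhat ∈ DiagProd.Tr (DiagProd.diagonalProduct S θ) ∧
        DiagProd.RestrictsToHomeomorph (DiagProd.twist S hθ φhat)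
          (DiagProd.compatibleTraces S hθ φ) (DiagProd.tracesOver S θ φ) ∧
        DiagProd.RestrictsToHomeomorph (DiagProd.twist S hθ φhat)
          (DiagProd.compatibleCharacters S hθ φ)
          (DiagProd.tracesOver S θ φ ∩ DiagProd.Ch (DiagProd.diagonalProduct S θ))) ∧
    -- characters of the diagonal product, for every choice of auxiliary traces
    (∀ aux : (∀ n, H n → ℂ) → (DiagProd.diagonalProduct S θ → ℂ),
      (∀ φ, (∀ n, φ n ∈ DiagProd.Ch (H n)) → DiagProd.IsAuxiliary S θ φ (aux φ)) →
      Set.BijOn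
        (fun p : (∀ n, H n → ℂ) × (G → ℂ) => DiagProd.twist S hθ (aux p.1) p.2)
        {p | (∀ n, p.1 n ∈ DiagProd.Ch (H n)) ∧ p.2 ∈ DiagProd.compatibleCharacters S hθ p.1}
        (DiagProd.Ch (DiagProd.diagonalProduct S θ))) :=
  theorem1p4_general S hSgen θ hθ hess
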